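/- For an integer $t\ge 1$ let $f_t=\prod_{n\ge 1}(1-q^{nt})$, and for $k\ge 1$ define $p_k(n)$ by $f_1^k=\sum_{n\ge 0}p_k(n)q^n$, with $p_k(n)=0$ for $n<0$. For $k\in\{1,2,3\}$ define integers $f(k),g(k)$ and two integer sequences $(A_k(\alpha))_{\alpha\ge 0}$, $(B_k(\alpha))_{\alpha\ge 0}$ by the recurrences $$A_k(\alpha+4)=f(k)A_k(\alpha+2)+g(k)A_k(\alpha),\qquad B_k(\alpha+4)=f(k)B_k(\alpha+2)+g(k)B_k(\alpha)\qquad(\alpha\ge 0)$$ and the following data: - $k=1$: $f(1)=-2^3$, $g(1)=0$; $(A_1(0),A_1(1),A_1(2),A_1(3))=(1,-8,-8,64)$; $(B_1(0),B_1(1),B_1(2),B_1(3))=(0,0,0,0)$, so that $B_1$ vanishes identically. - $k=2$: $f(2)=2^3\cdot 13$, $g(2)=-2^{14}$; $(A_2(0),A_2(1),A_2(2),A_2(3))=(1,128,104,-3072)$; $(B_2(0),B_2(1),B_2(2),B_2(3))=(0,1,-2048,104)$. - $k=3$: $f(3)=-2^6\cdot 5\cdot 11$, $g(3)=-2^{22}$;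 $(A_3(0),A_3(1),A_3(2),A_3(3))=(1,-2048,-1472,3014656)$; $(B_3(0),B_3(1),B_3(2),B_3(3))=(0,-24,49152,84480)$. **Theorem.** For all integers $\alpha\ge 0$ and $1\le k\le 3$, the following identities of formal Laurent series in $q$ hold: $$\sum_{n=0}^{\infty}p_{8k}\Big(2^{2\alpha}n+\frac{k(2^{2\alpha}-1)}{3}\Big)q^n=A_k(2\alpha)\,f_1^{8k}+B_k(2\alpha)\,q^{\lfloor k/2\rfloor}f_1^{8k-24}f_2^{24},$$ $$\sum_{n=-\lfloor k/2\rfloor}^{\infty}p_{8k}\Big(2^{2\alpha+1}n+\frac{k(2^{2\alpha+2}-1)}{3}\Big)q^n=A_k(2\alpha+1)\,f_2^{8k}+B_k(2\alpha+1)\,q^{-\lfloor k/2\rfloor}f_1^{24}f_2^{8k-24}.$$ -/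

import Mathlib

open scoped PowerSeries.WithPiTopology in
/-- The formal product `f_t = ∏_{n ≥ 1} (1 - q ^ (n t)) ∈ ℤ⟦q⟧` (used for `t ≥ 1`): the limit of
the partial products for coefficientwise convergence, `ℤ` being discrete. -/
noncomputable def eulerProd (t : ℕ) : PowerSeries ℤ :=
  ∏' n : ℕ, (1 - (PowerSeries.X : PowerSeries ℤ) ^ ((n + 1) * t))

open scoped PowerSeries.WithPiTopology in
/-- The infinite product defining `f_t` converges. -/
theorem multipliable_eulerProd (t : ℕ) (ht : 1 ≤ t) :
    Multipliable fun n : ℕ => (1 - (PowerSeries.X : PowerSeries ℤ) ^ ((n + 1) * t)) := by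
  simp only [sub_eq_add_neg]
  apply PowerSeries.WithPiTopology.multipliable_one_add_of_tendsto_order_atTop_nhds_top
  refine ENat.tendsto_nhds_top_iff_natCast_lt.mpr fun m => Filter.eventually_atTop.mpr ⟨m, ?_⟩
  intro n hn
  rw [PowerSeries.order_neg, PowerSeries.order_X_pow]
  exact_mod_cast (by nlinarith : m < (n + 1) * t)

open scoped PowerSeries.WithPiTopology in
theorem constantCoeff_eulerProd (t : ℕ) (ht : 1 ≤ t) :
    PowerSeries.constantCoeff (eulerProd t) = 1 := by
  have h := (multipliable_eulerProd t ht).map_tprod (PowerSeries.constantCoeff (R := ℤ))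
    (PowerSeries.WithPiTopology.continuous_constantCoeff ℤ)
  rw [eulerProd, h]
  have : ∀ n : ℕ, PowerSeries.constantCoeff
      (1 - (PowerSeries.X : PowerSeries ℤ) ^ ((n + 1) * t)) = 1 := by
    intro n
    have : (n + 1) * t ≠ 0 := by positivity
    simp [this]
  simp [this]

/-- `p_k(n)`, the coefficient of `q ^ n` in `f_1 ^ k`; it is `0` for negative `n`. -/
noncomputable def pCoeff (k : ℕ) (n : ℤ) : ℤ :=
  if 0 ≤ n then PowerSeries.coeff n.toNat (eulerProd 1 ^ k) else 0

/-- `f_t` as an element of the field of formal Laurent series over `ℚ`, where its negative powers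
are available. -/
noncomputable def eulerLaurent (t : ℕ) : LaurentSeries ℚ :=
  HahnSeries.ofPowerSeries ℤ ℚ ((eulerProd t).map (Int.castRingHom ℚ))

/-- `f_t` is invertible, so that its integer powers have their usual meaning. -/
theorem eulerLaurent_ne_zero (t : ℕ) (ht : 1 ≤ t) : eulerLaurent t ≠ 0 := by
  intro h
  have h1 : (eulerProd t).map (Int.castRingHom ℚ) = 0 :=
    HahnSeries.ofPowerSeries_injective (h.trans (map_zero _).symm)
  have h2 := congrArg PowerSeries.constantCoeff h1
  rw [← PowerSeries.coeff_zero_eq_constantCoeff_apply, PowerSeries.coeff_map,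
    PowerSeries.coeff_zero_eq_constantCoeff_apply, constantCoeff_eulerProd t ht] at h2
  simp at h2

/-- The monomial `q ^ n`, `n ∈ ℤ`. -/
noncomputable def qPow (n : ℤ) : LaurentSeries ℚ :=
  HahnSeries.single n 1

/-- The formal Laurent series `∑_{n ≥ N} a(n) q ^ n`. -/
noncomputable def laurentSum (N : ℤ) (a : ℤ → ℤ) : LaurentSeries ℚ :=
  HahnSeries.ofSuppBddBelow (fun n => if N ≤ n then (a n : ℚ) else 0)
    ⟨N, fun n hn => by
      by_contra hlt
      exact hn (if_neg hlt)⟩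

/-- The coefficient `f(k)` of the recurrence. -/
def recF : ℕ → ℤ
  | 1 => -2 ^ 3
  | 2 => 2 ^ 3 * 13
  | 3 => -(2 ^ 6 * 5 * 11)
  | _ => 0

/-- The coefficient `g(k)` of the recurrence. -/
def recG : ℕ → ℤ
  | 1 => 0
  | 2 => -2 ^ 14
  | 3 => -2 ^ 22
  | _ => 0

/-- The initial values `A_k(0), A_k(1), A_k(2), A_k(3)`. -/
def initA : ℕ → Fin 4 → ℤ
  | 1 => ![1, -8, -8, 64]
  | 2 => ![1, 128, 104, -3072]
  | 3 => ![1, -2048, -1472, 3014656]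
  | _ => 0

/-- The initial values `B_k(0), B_k(1), B_k(2), B_k(3)`. -/
def initB : ℕ → Fin 4 → ℤ
  | 1 => ![0, 0, 0, 0]
  | 2 => ![0, 1, -2048, 104]
  | 3 => ![0, -24, 49152, 84480]
  | _ => 0

/-!
Write `f_t = eulerProd t`. Everything follows from the parity of one series: the odd part of
`f_1 ^ 8` is `-8 q f_4 ^ 8` (`evalNegHom_eulerProd_pow_eight`). Together with the product formula
`f_1(-q) f_1 f_4 = f_2 ^ 3` it makes `f_1 ^ 8` a root of an explicit quadratic over the series in
`q ^ 2`, whose conjugate root is `f_1(-q) ^ 8`. Trace and norm give the even part of `f_1 ^ 16` and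
the odd part of `f_1 ^ 24`.

Extracting the coefficients of index `4 ^ α n + k (4 ^ α - 1) / 3` is the same as bisecting `2 α`
times, alternately along `2 n + (k mod 2)` and `2 n + ⌊k / 2⌋` once the Laurent series of the odd
stages are multiplied by `q ^ ⌊k / 2⌋` (`coeff_evenSection`). By the parity facts the two bisections
exchange two spaces of dimension two (`bisect_mod_two`, `bisect_div_two`). The numbers `A_k`, `B_k`
are the coordinates of the iterates of `f_1 ^ (8 k)`, and their recurrence is the Cayley–Hamilton
theorem for the product of the two transition matrices (`coords_add_four`).

The odd part of `f_1 ^ 8` is Jacobi's identity `φ(q) ^ 4 - φ(-q) ^ 4 = 16 q f_4 ^ 8 / f_2 ^ 4` for the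
theta series `φ(q) = ∑ q ^ (m ^ 2)`. It uses only Gauss's product `φ(-q) = f_1 ^ 2 / f_2`
(`eulerProd_one_sq`, the limit of a finite telescoping identity) and
`φ(q) ^ 2 + φ(-q) ^ 2 = 2 φ(q ^ 2) ^ 2` (`theta_sq_add`): these imply that both sides of Jacobi's
identity solve `y(q) ^ 2 = 16 φ(q ^ 2) ^ 4 y(q ^ 2)`, and such an equation has only one solution with
a given leading term (`eq_of_sq_eq_mul_expand`).
-/

open PowerSeries

/-! ### Euler products -/

open scoped PowerSeries.WithPiTopology in
theorem continuous_expand_two :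
    Continuous (expand 2 two_ne_zero : PowerSeries ℤ → PowerSeries ℤ) := by
  refine continuous_iff_continuousAt.2 fun a => ?_
  refine (WithPiTopology.tendsto_iff_coeff_tendsto _ _ _ _).2 fun d => ?_
  simp only [coeff_expand]
  split_ifs
  · exact (WithPiTopology.continuous_coeff ℤ _).continuousAt
  · exact tendsto_const_nhds

open scoped PowerSeries.WithPiTopology in
theorem continuous_evalNegHom : Continuous (evalNegHom : PowerSeries ℤ → PowerSeries ℤ) := by
  refine continuous_iff_continuousAt.2 fun a => ?_
  refine (WithPiTopology.tendsto_iff_coeff_tendsto _ _ _ _).2 fun d => ?_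
  simp only [evalNegHom, coeff_rescale]
  exact ((WithPiTopology.continuous_coeff ℤ d).continuousAt (x := a)).tendsto.const_mul _

theorem coeff_evalNegHom (a : PowerSeries ℤ) (n : ℕ) :
    coeff n (evalNegHom a) = (-1) ^ n * coeff n a := by
  simp [evalNegHom, coeff_rescale]

theorem evalNegHom_expand_two (a : PowerSeries ℤ) :
    evalNegHom (expand 2 two_ne_zero a) = expand 2 two_ne_zero a := by
  ext n
  rw [coeff_evalNegHom, coeff_expand]
  split_ifs with h
  · rw [(even_iff_two_dvd.2 h).neg_one_pow, one_mul]
  · simp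

open scoped PowerSeries.WithPiTopology in
theorem expand_two_eulerProd (t : ℕ) (ht : 1 ≤ t) :
    expand 2 two_ne_zero (eulerProd t) = eulerProd (2 * t) := by
  have h := (multipliable_eulerProd t ht).map_tprod (expand 2 two_ne_zero (R := ℤ))
    continuous_expand_two
  rw [eulerProd, h, eulerProd]
  refine tprod_congr fun n => ?_
  simp only [map_sub, map_one, map_pow, expand_X, ← pow_mul]
  congr 2
  ring

theorem evalNegHom_eulerProd_two_mul (t : ℕ) (ht : 1 ≤ t) :
    evalNegHom (eulerProd (2 * t)) = eulerProd (2 * t) := by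
  rw [← expand_two_eulerProd t ht, evalNegHom_expand_two]

open scoped PowerSeries.WithPiTopology in
theorem multipliable_one_sub_X_pow_odd :
    Multipliable fun n : ℕ => (1 - (X : PowerSeries ℤ) ^ (2 * n + 1)) := by
  simp only [sub_eq_add_neg]
  apply WithPiTopology.multipliable_one_add_of_tendsto_order_atTop_nhds_top
  refine ENat.tendsto_nhds_top_iff_natCast_lt.mpr fun m => Filter.eventually_atTop.mpr ⟨m, ?_⟩
  intro n hn
  rw [order_neg, order_X_pow]
  exact_mod_cast (by omega : m < 2 * n + 1)

open scoped PowerSeries.WithPiTopology in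
/-- The product `∏ (1 - q ^ n)` over odd `n`. -/
noncomputable def oddProd : PowerSeries ℤ := ∏' n : ℕ, (1 - (X : PowerSeries ℤ) ^ (2 * n + 1))

open scoped PowerSeries.WithPiTopology in
theorem eulerProd_one_eq : eulerProd 1 = oddProd * eulerProd 2 := by
  have h2 := multipliable_eulerProd 2 one_le_two
  have h := tprod_even_mul_odd (f := fun n : ℕ => (1 - (X : PowerSeries ℤ) ^ ((n + 1) * 1)))
    (by simpa only [mul_one] using multipliable_one_sub_X_pow_odd)
    (by convert h2 using 4; ring)
  rw [eulerProd, ← h, oddProd, eulerProd]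
  congr 1
  · simp only [mul_one]
  · refine tprod_congr fun n => ?_
    congr 2
    ring

open scoped PowerSeries.WithPiTopology in
theorem evalNegHom_oddProd_mul_oddProd :
    evalNegHom oddProd * oddProd = expand 2 two_ne_zero oddProd := by
  have hm := multipliable_one_sub_X_pow_odd
  rw [oddProd, hm.map_tprod (evalNegHom (A := ℤ)) continuous_evalNegHom,
    hm.map_tprod (expand 2 two_ne_zero (R := ℤ)) continuous_expand_two,
    ← Multipliable.tprod_mul (f := fun n => evalNegHom (1 - (X : PowerSeries ℤ) ^ (2 * n + 1)))
      (hm.map (evalNegHom (A := ℤ)) continuous_evalNegHom) hm]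
  refine tprod_congr fun n => ?_
  simp only [map_sub, map_one, map_pow, evalNegHom_X, expand_X]
  rw [Odd.neg_pow ⟨n, rfl⟩]
  ring

/-- The product form of the substitution `q ↦ -q`: `f_1(-q) f_1 f_4 = f_2 ^ 3`. -/
theorem evalNegHom_eulerProd_one :
    evalNegHom (eulerProd 1) * eulerProd 1 * eulerProd 4 = eulerProd 2 ^ 3 := by
  have h4 : eulerProd 2 = expand 2 two_ne_zero oddProd * eulerProd 4 := by
    rw [← expand_two_eulerProd 2 one_le_two, ← map_mul, ← eulerProd_one_eq,
      expand_two_eulerProd 1 le_rfl]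
  have h2 : evalNegHom (eulerProd 2) = eulerProd 2 := evalNegHom_eulerProd_two_mul 1 le_rfl
  calc evalNegHom (eulerProd 1) * eulerProd 1 * eulerProd 4
      = eulerProd 2 ^ 2 * ((evalNegHom oddProd * oddProd) * eulerProd 4) := by
        rw [eulerProd_one_eq, map_mul, h2]; ring
    _ = eulerProd 2 ^ 3 := by rw [evalNegHom_oddProd_mul_oddProd, ← h4]; ring

open scoped PowerSeries.WithPiTopology in
/-- The product `f_t` agrees with its `n`-th partial product modulo `q ^ (n + 1)`. -/
theorem X_pow_dvd_eulerProd_sub (t : ℕ) (ht : 1 ≤ t) (n : ℕ) :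
    X ^ (n + 1) ∣
      eulerProd t - ∏ k ∈ Finset.range n, (1 - (X : PowerSeries ℤ) ^ ((k + 1) * t)) := by
  have htail (s : Finset ℕ) (hs : ∀ k ∈ s, n ≤ k) :
      X ^ (n + 1) ∣ (∏ k ∈ s, (1 - (X : PowerSeries ℤ) ^ ((k + 1) * t))) - 1 := by
    classical
    induction s using Finset.induction_on with
    | empty => simp
    | insert a s ha ih =>
      rw [Finset.prod_insert ha]
      have h1 := ih fun k hk => hs k (Finset.mem_insert_of_mem hk)
      have h2 : (X : PowerSeries ℤ) ^ (n + 1) ∣ X ^ ((a + 1) * t) :=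
        pow_dvd_pow _ (by nlinarith [hs a (Finset.mem_insert_self a s)])
      have := h1.sub (h2.mul_right (∏ k ∈ s, (1 - (X : PowerSeries ℤ) ^ ((k + 1) * t))))
      convert this using 1
      ring
  have hclosed : IsClosed {a : PowerSeries ℤ | ∀ m < n + 1, coeff m a = coeff m
      (∏ k ∈ Finset.range n, (1 - (X : PowerSeries ℤ) ^ ((k + 1) * t)))} := by
    simp only [Set.ofPred_forall]
    exact isClosed_iInter fun m => isClosed_iInter fun _ =>
      isClosed_eq (WithPiTopology.continuous_coeff ℤ m) continuous_const
  have hmem := hclosed.mem_of_tendsto (multipliable_eulerProd t ht).hasProd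
    (Filter.eventually_atTop.2 ⟨Finset.range n, fun s hs m hm => ?_⟩)
  · rw [X_pow_dvd_iff]
    intro m hm
    rw [map_sub, sub_eq_zero]
    exact hmem m hm
  · have h1 := (htail (s \ Finset.range n) fun k hk => by
      simpa using (Finset.mem_sdiff.1 hk).2).mul_right
        (∏ k ∈ Finset.range n, (1 - (X : PowerSeries ℤ) ^ ((k + 1) * t)))
    rw [sub_mul, Finset.prod_sdiff hs, one_mul, X_pow_dvd_iff] at h1
    have := h1 m hm
    rwa [map_sub, sub_eq_zero] at this

/-! ### Gauss's theta series -/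

/-- Shanks's finite form of Gauss's identity
`1 + 2 ∑ (-1) ^ s q ^ (s ^ 2) = ∏ (1 - q ^ k) / (1 + q ^ k)`, cleared of denominators.
Its right-hand side is congruent to `∏ (1 - q ^ k)` modulo `q ^ (n + 1)`. -/
theorem gauss_finite {R : Type*} [CommRing R] (q : R) (n : ℕ) :
    (1 + 2 * ∑ s ∈ Finset.range n, (-1) ^ (s + 1) * q ^ (s + 1) ^ 2) *
        ∏ k ∈ Finset.range n, (1 + q ^ (k + 1)) =
      ∏ k ∈ Finset.range n, (1 - q ^ (k + 1)) +
        2 * ∑ s ∈ Finset.range n, (-1) ^ (s + 1) * q ^ ((s + 1) * (n + 1)) *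
          (∏ k ∈ Finset.range s, (1 + q ^ (k + 1))) *
          ∏ k ∈ Finset.Ico (s + 1) n, (1 - q ^ (k + 1)) := by
  induction n with
  | zero => simp
  | succ n ih =>
    set D : ℕ → R := fun s => ∏ k ∈ Finset.range s, (1 + q ^ (k + 1)) with hD
    set N : ℕ → ℕ → R := fun s n => ∏ k ∈ Finset.Ico s n, (1 - q ^ (k + 1)) with hN
    have hDs (s : ℕ) : D (s + 1) = D s * (1 + q ^ (s + 1)) := Finset.prod_range_succ _ _
    have hNn (s : ℕ) (h : s ≤ n) : N s (n + 1) = N s n * (1 - q ^ (n + 1)) :=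
      Finset.prod_Ico_succ_top h _
    have hNs (s : ℕ) (h : s < n) : N s n = (1 - q ^ (s + 1)) * N (s + 1) n :=
      Finset.prod_eq_prod_Ico_succ_bot h _
    have hN0 (n : ℕ) : ∏ k ∈ Finset.range n, (1 - q ^ (k + 1)) = N 0 n := by
      simp only [hN, Finset.range_eq_Ico]
    have hself (n : ℕ) : N n n = 1 := by simp [hN]
    change _ * D n = _ + 2 * ∑ s ∈ Finset.range n, (-1) ^ (s + 1) * q ^ ((s + 1) * (n + 1)) *
      D s * N (s + 1) n at ih
    change _ * D (n + 1) = _ + 2 * ∑ s ∈ Finset.range (n + 1),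
      (-1) ^ (s + 1) * q ^ ((s + 1) * (n + 1 + 1)) * D s * N (s + 1) (n + 1)
    rw [hN0] at ih ⊢
    -- The difference of two consecutive right-hand sums telescopes.
    have htel := Finset.sum_range_sub'
      (fun s => (-1) ^ s * q ^ ((s + 1) * (n + 1)) * D s * N s n) n
    have hstep : ∑ s ∈ Finset.range n,
          (-1) ^ (s + 1) * q ^ ((s + 1) * (n + 1 + 1)) * D s * N (s + 1) (n + 1) =
        (1 + q ^ (n + 1)) * ∑ s ∈ Finset.range n,
          (-1) ^ (s + 1) * q ^ ((s + 1) * (n + 1)) * D s * N (s + 1) n +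
        ∑ s ∈ Finset.range n, ((-1) ^ s * q ^ ((s + 1) * (n + 1)) * D s * N s n -
          (-1) ^ (s + 1) * q ^ ((s + 1 + 1) * (n + 1)) * D (s + 1) * N (s + 1) n) := by
      rw [Finset.mul_sum, ← Finset.sum_add_distrib]
      refine Finset.sum_congr rfl fun s hs => ?_
      have hs := Finset.mem_range.1 hs
      rw [hNn (s + 1) hs, hNs s hs, hDs]
      ring
    rw [Finset.sum_range_succ, Finset.sum_range_succ, hstep, htel, hself, hself, hNn 0 n.zero_le,
      hDs]
    have hD0 : D 0 = 1 := by simp [hD]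
    rw [hD0]
    linear_combination (1 + q ^ (n + 1)) * ih

/-- The integers with square `n`. -/
noncomputable def sqRoots (n : ℕ) : Finset ℤ := {x ∈ Finset.Icc (-(n : ℤ)) n | x ^ 2 = n}

theorem mem_sqRoots {n : ℕ} {x : ℤ} : x ∈ sqRoots n ↔ x ^ 2 = n := by
  simp only [sqRoots, Finset.mem_filter, Finset.mem_Icc, and_iff_right_iff_imp]
  intro h
  rw [← h]
  constructor <;> nlinarith [Int.le_self_sq x, Int.le_self_sq (-x)]

/-- The theta series `φ(q) = ∑ q ^ (m ^ 2)`, summed over `m ∈ ℤ`: the coefficient of `q ^ n` is the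
number of integers with square `n`. -/
noncomputable def theta : PowerSeries ℤ := mk fun n => ((sqRoots n).card : ℤ)

theorem coeff_theta (n : ℕ) : coeff n theta = ((sqRoots n).card : ℤ) := coeff_mk _ _

theorem sqRoots_zero : sqRoots 0 = {0} := by
  ext x
  simp [mem_sqRoots]

theorem sqRoots_sq (r : ℕ) : sqRoots (r ^ 2) = {(r : ℤ), -(r : ℤ)} := by
  ext x
  simp [mem_sqRoots, sq_eq_sq_iff_eq_or_eq_neg]

theorem constantCoeff_theta : constantCoeff theta = 1 := by
  rw [← coeff_zero_eq_constantCoeff_apply, coeff_theta, sqRoots_zero]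
  simp

theorem coeff_evalNegHom_theta (m n : ℕ) (h : m ≤ n) :
    coeff m (evalNegHom theta) = coeff m
      (1 + 2 * ∑ s ∈ Finset.range n, (-1) ^ (s + 1) * (X : PowerSeries ℤ) ^ (s + 1) ^ 2) := by
  have hc (s : ℕ) : coeff m ((-1) ^ (s + 1) * (X : PowerSeries ℤ) ^ (s + 1) ^ 2) =
      if m = (s + 1) ^ 2 then (-1) ^ (s + 1) else 0 := by
    have : ((-1) ^ (s + 1) * (X : PowerSeries ℤ) ^ (s + 1) ^ 2) =
        C ((-1) ^ (s + 1)) * X ^ (s + 1) ^ 2 := by simp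
    rw [this, coeff_C_mul, coeff_X_pow]
    simp
  have h2 (a : PowerSeries ℤ) : coeff m (2 * a) = 2 * coeff m a := by
    rw [two_mul, map_add, two_mul]
  rw [coeff_evalNegHom, coeff_theta, map_add, h2, map_sum, coeff_one]
  simp only [hc]
  by_cases hm : ∃ r, m = r ^ 2
  · obtain ⟨r, rfl⟩ := hm
    rw [sqRoots_sq]
    rcases r with _ | r
    · have : ∀ s, ¬ (0 = (s + 1) ^ 2) := fun s => (by positivity : 0 < (s + 1) ^ 2).ne
      simp [this]
    · have hr : r < n := by nlinarith
      have hiff (s : ℕ) : (r + 1) ^ 2 = (s + 1) ^ 2 ↔ r = s := by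
        rw [Nat.pow_left_inj two_ne_zero]
        omega
      have hne : ((r + 1 : ℕ) : ℤ) ≠ -((r + 1 : ℕ) : ℤ) := by omega
      simp only [hiff, Finset.sum_ite_eq, Finset.mem_range, hr, if_true]
      rw [Finset.card_pair hne, if_neg (by positivity)]
      have : ((-1 : ℤ)) ^ (r + 1) ^ 2 = (-1) ^ (r + 1) := by
        rw [sq, pow_mul]
        rcases neg_one_pow_eq_or ℤ (r + 1) with h | h
        · rw [h, one_pow]
        · rw [h, h]
      rw [this]
      push_cast
      ring
  · have h0 : m ≠ 0 := fun h => hm ⟨0, by simpa using h⟩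
    have h1 (s : ℕ) : ¬ m = (s + 1) ^ 2 := fun h => hm ⟨_, h⟩
    have h3 : sqRoots m = ∅ := by
      refine Finset.eq_empty_of_forall_notMem fun x hx => hm ⟨x.natAbs, ?_⟩
      have := mem_sqRoots.1 hx
      zify
      rw [sq_abs, this]
    simp [h0, h1, h3]

/-- **Gauss's identity** `f_1 ^ 2 / f_2 = ∑ (-1) ^ m q ^ (m ^ 2)`. -/
theorem eulerProd_one_sq : eulerProd 1 ^ 2 = eulerProd 2 * evalNegHom theta := by
  rw [← sub_eq_zero]
  ext n
  rw [map_zero]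
  refine X_pow_dvd_iff.1 ?_ n n.lt_succ_self
  have h1 := X_pow_dvd_eulerProd_sub 1 le_rfl n
  have h2 := X_pow_dvd_eulerProd_sub 2 one_le_two n
  have h3 : X ^ (n + 1) ∣ evalNegHom theta -
      (1 + 2 * ∑ s ∈ Finset.range n, (-1) ^ (s + 1) * (X : PowerSeries ℤ) ^ (s + 1) ^ 2) := by
    refine X_pow_dvd_iff.2 fun m hm => ?_
    rw [map_sub, sub_eq_zero]
    exact coeff_evalNegHom_theta m n (by omega)
  have h4 : (X : PowerSeries ℤ) ^ (n + 1) ∣ ∑ s ∈ Finset.range n,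
      (-1) ^ (s + 1) * X ^ ((s + 1) * (n + 1)) *
          (∏ k ∈ Finset.range s, (1 + X ^ (k + 1))) *
          ∏ k ∈ Finset.Ico (s + 1) n, (1 - X ^ (k + 1)) :=
    Finset.dvd_sum fun s _ => (((pow_dvd_pow _ (by nlinarith)).mul_left _).mul_right _).mul_right _
  have h5 := gauss_finite (X : PowerSeries ℤ) n
  have h6 : ∏ k ∈ Finset.range n, (1 - (X : PowerSeries ℤ) ^ ((k + 1) * 2)) =
      (∏ k ∈ Finset.range n, (1 - (X : PowerSeries ℤ) ^ (k + 1))) *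
        ∏ k ∈ Finset.range n, (1 + X ^ (k + 1)) := by
    rw [← Finset.prod_mul_distrib]
    exact Finset.prod_congr rfl fun k _ => by ring
  rw [h6] at h2
  simp only [mul_one] at h1
  generalize (∏ k ∈ Finset.range n, (1 - (X : PowerSeries ℤ) ^ (k + 1))) = N at *
  generalize (∏ k ∈ Finset.range n, (1 + (X : PowerSeries ℤ) ^ (k + 1))) = D at *
  generalize (1 + 2 * ∑ s ∈ Finset.range n,
    (-1) ^ (s + 1) * (X : PowerSeries ℤ) ^ (s + 1) ^ 2) = S at *
  generalize (∑ s ∈ Finset.range n, (-1) ^ (s + 1) * (X : PowerSeries ℤ) ^ ((s + 1) * (n + 1)) *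
          (∏ k ∈ Finset.range s, (1 + (X : PowerSeries ℤ) ^ (k + 1))) *
          ∏ k ∈ Finset.Ico (s + 1) n, (1 - (X : PowerSeries ℤ) ^ (k + 1))) = W at *
  have := (((h1.mul_right (eulerProd 1 + N)).sub (h2.mul_right (evalNegHom theta))).sub
    (h3.mul_right (N * D))).sub (h4.mul_right (2 * N))
  convert this using 1
  linear_combination (-N) * h5

/-! ### Sums of two squares -/

/-- The representations of `n` as a sum of two squares. -/
noncomputable def sqPairs (n : ℕ) : Finset (ℤ × ℤ) :=
  {p ∈ Finset.Icc (-(n : ℤ)) n ×ˢ Finset.Icc (-(n : ℤ)) n | p.1 ^ 2 + p.2 ^ 2 = n}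

theorem mem_sqPairs {n : ℕ} {p : ℤ × ℤ} : p ∈ sqPairs n ↔ p.1 ^ 2 + p.2 ^ 2 = n := by
  obtain ⟨x, y⟩ := p
  simp only [sqPairs, Finset.mem_filter, Finset.mem_product, Finset.mem_Icc,
    and_iff_right_iff_imp]
  intro h
  rw [← h]
  have h1 := Int.le_self_sq x
  have h2 := Int.le_self_sq (-x)
  have h3 := Int.le_self_sq y
  have h4 := Int.le_self_sq (-y)
  rw [neg_sq] at h2 h4
  refine ⟨⟨?_, ?_⟩, ?_, ?_⟩ <;> nlinarith [sq_nonneg x, sq_nonneg y]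

theorem coeff_theta_sq (n : ℕ) : coeff n (theta ^ 2) = ((sqPairs n).card : ℤ) := by
  rw [sq, coeff_mul, Finset.card_eq_sum_card_fiberwise
    (f := fun p : ℤ × ℤ => (p.1.natAbs ^ 2, p.2.natAbs ^ 2))
    (t := Finset.HasAntidiagonal.antidiagonal n)]
  · push_cast
    refine Finset.sum_congr rfl fun ab hab => ?_
    rw [coeff_theta, coeff_theta, ← Nat.cast_mul, ← Finset.card_product]
    congr 2
    ext ⟨x, y⟩
    obtain ⟨a, b⟩ := ab
    have hab : a + b = n := Finset.HasAntidiagonal.mem_antidiagonal.1 hab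
    simp only [Finset.mem_product, mem_sqRoots, Finset.mem_filter, mem_sqPairs, Prod.mk.injEq]
    zify at hab ⊢
    simp only [sq_abs]
    constructor
    · rintro ⟨h1, h2⟩
      exact ⟨by rw [h1, h2, hab], h1, h2⟩
    · exact fun h => h.2
  · intro p hp
    have hp := mem_sqPairs.1 hp
    simp only [Finset.mem_coe, Finset.HasAntidiagonal.mem_antidiagonal]
    zify
    simpa only [sq_abs] using hp

/-- The bijection is `(x, y) ↦ (x + y, x - y)`, multiplication by `1 + i` up to conjugation. -/
theorem card_sqPairs_two_mul (n : ℕ) : (sqPairs (2 * n)).card = (sqPairs n).card := by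
  symm
  refine Finset.card_bij (fun p _ => (p.1 + p.2, p.1 - p.2)) ?_ ?_ ?_
  · intro p hp
    rw [mem_sqPairs] at hp ⊢
    push_cast
    linear_combination 2 * hp
  · rintro ⟨a, b⟩ _ ⟨c, d⟩ _ h
    simp only [Prod.mk.injEq] at h ⊢
    omega
  · rintro ⟨x, y⟩ h
    rw [mem_sqPairs] at h
    push_cast at h
    have hev : Even (x + y) := by
      have : Even (x ^ 2 + y ^ 2) := ⟨n, by linarith⟩
      simpa [Int.even_add, Int.even_pow] using this
    obtain ⟨u, hu⟩ := hev
    refine ⟨(u, x - u), ?_, ?_⟩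
    · rw [mem_sqPairs]
      have hy : y = 2 * u - x := by linarith
      subst hy
      simp only
      linarith
    · simp only [Prod.mk.injEq]
      omega

/-- The even part of `φ(q) ^ 2` is `φ(q ^ 2) ^ 2`. -/
theorem theta_sq_add :
    theta ^ 2 + evalNegHom theta ^ 2 = 2 * expand 2 two_ne_zero theta ^ 2 := by
  rw [← map_pow, ← map_pow, two_mul]
  ext n
  rw [map_add, map_add, coeff_evalNegHom, coeff_expand]
  split_ifs with h
  · obtain ⟨m, rfl⟩ := h
    rw [(even_two_mul m).neg_one_pow, Nat.mul_div_cancel_left _ two_pos, coeff_theta_sq,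
      coeff_theta_sq, card_sqPairs_two_mul, one_mul]
  · rw [(Nat.not_even_iff_odd.1 fun h' => h h'.two_dvd).neg_one_pow]
    ring

/-! ### Jacobi's quartic identity -/

/-- A solution of `y(q) ^ 2 = c(q) y(q ^ 2)` is determined by its constant term: if `y - z` has
order `m > 0`, then `(y - z) (y + z)` has order `m`, but `c (y - z)(q ^ 2)` has order `≥ 2 m`. -/
theorem eq_of_sq_eq_mul_expand {c y z : PowerSeries ℤ}
    (hy : y ^ 2 = c * expand 2 two_ne_zero y) (hz : z ^ 2 = c * expand 2 two_ne_zero z)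
    (h : constantCoeff y = constantCoeff z) (h0 : constantCoeff y ≠ 0) : y = z := by
  rw [← sub_eq_zero]
  have key : (y - z) * (y + z) = c * expand 2 two_ne_zero (y - z) := by
    rw [map_sub]
    linear_combination hy - hz
  have hdvd (n : ℕ) : X ^ (n + 1) ∣ y - z := by
    induction n with
    | zero => rw [zero_add, pow_one, X_dvd_iff, map_sub, h, sub_self]
    | succ n ih =>
      obtain ⟨d, hd⟩ := ih
      rw [hd, map_mul, map_pow, expand_X] at key
      have hX : (X : PowerSeries ℤ) ^ (n + 1) ≠ 0 := pow_ne_zero _ X_ne_zero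
      have key' : d * (y + z) = X ^ (n + 1) * (c * expand 2 two_ne_zero d) := by
        refine mul_left_cancel₀ hX ?_
        linear_combination key
      have hd0 := congrArg constantCoeff key'
      rw [map_mul, map_mul, map_pow, constantCoeff_X, map_add, ← h, zero_pow n.succ_ne_zero,
        zero_mul, mul_eq_zero, ← two_mul, mul_eq_zero] at hd0
      obtain ⟨e, rfl⟩ := X_dvd_iff.2 (hd0.resolve_right (by simp [h0]))
      exact ⟨e, by rw [hd]; ring⟩
  ext n
  rw [map_zero]
  exact X_pow_dvd_iff.1 (hdvd n) n n.lt_succ_self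

theorem eulerProd_ne_zero (t : ℕ) (ht : 1 ≤ t) : eulerProd t ≠ 0 := by
  intro h
  have := constantCoeff_eulerProd t ht
  rw [h, map_zero] at this
  exact zero_ne_one this

theorem exists_mul_eulerProd_eq_one (t : ℕ) (ht : 1 ≤ t) : ∃ g, eulerProd t * g = 1 :=
  (isUnit_iff_constantCoeff.2
    (by rw [constantCoeff_eulerProd t ht]; exact isUnit_one)).exists_right_inv

theorem evalNegHom_evalNegHom (a : PowerSeries ℤ) : evalNegHom (evalNegHom a) = a := by
  ext n
  rw [coeff_evalNegHom, coeff_evalNegHom, ← mul_assoc, ← mul_pow]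
  simp

theorem evalNegHom_eulerProd_one_sq :
    evalNegHom (eulerProd 1) ^ 2 = eulerProd 2 * theta := by
  rw [← map_pow, eulerProd_one_sq, map_mul, evalNegHom_evalNegHom,
    evalNegHom_eulerProd_two_mul 1 le_rfl]

theorem eulerProd_two_sq :
    eulerProd 2 ^ 2 = eulerProd 4 * expand 2 two_ne_zero (evalNegHom theta) := by
  have := congrArg (expand 2 two_ne_zero) eulerProd_one_sq
  rwa [map_pow, map_mul, expand_two_eulerProd 1 le_rfl, expand_two_eulerProd 2 one_le_two] at this

/-- The product form of `φ(q ^ 2)`. -/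
theorem expand_theta_mul :
    expand 2 two_ne_zero theta * eulerProd 2 ^ 2 * eulerProd 8 ^ 2 = eulerProd 4 ^ 5 := by
  have h1 : theta * eulerProd 1 ^ 2 * eulerProd 4 ^ 2 = eulerProd 2 ^ 5 := by
    refine mul_left_cancel₀ (eulerProd_ne_zero 2 one_le_two) ?_
    linear_combination (-eulerProd 1 ^ 2 * eulerProd 4 ^ 2) * evalNegHom_eulerProd_one_sq +
      (evalNegHom (eulerProd 1) * eulerProd 1 * eulerProd 4 + eulerProd 2 ^ 3) *
        evalNegHom_eulerProd_one
  have := congrArg (expand 2 two_ne_zero) h1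
  simpa only [map_mul, map_pow, expand_two_eulerProd 1 le_rfl, expand_two_eulerProd 2 one_le_two,
    expand_two_eulerProd 4 (by norm_num)] using this

theorem theta_mul_evalNegHom_theta :
    theta * evalNegHom theta = expand 2 two_ne_zero (evalNegHom theta) ^ 2 := by
  refine mul_left_cancel₀ (pow_ne_zero 2 (mul_ne_zero (eulerProd_ne_zero 2 one_le_two)
    (eulerProd_ne_zero 4 (by norm_num)))) ?_
  have h1 := evalNegHom_eulerProd_one_sq
  have h2 := eulerProd_one_sq
  have h3 := evalNegHom_eulerProd_one
  have h4 := eulerProd_two_sq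
  linear_combination (-eulerProd 4 ^ 2 * eulerProd 1 ^ 2) * h1 -
    eulerProd 4 ^ 2 * eulerProd 2 * theta * h2 +
    (evalNegHom (eulerProd 1) * eulerProd 1 * eulerProd 4 + eulerProd 2 ^ 3) * h3 +
    eulerProd 2 ^ 2 * (eulerProd 2 ^ 2 + eulerProd 4 * expand 2 two_ne_zero (evalNegHom theta)) * h4

/-- **Jacobi's identity** `φ(q) ^ 4 - φ(-q) ^ 4 = 16 q f_4 ^ 8 / f_2 ^ 4`. -/
theorem theta_pow_four_sub :
    eulerProd 2 ^ 4 * (theta ^ 4 - evalNegHom theta ^ 4) = 16 * X * eulerProd 4 ^ 8 := by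
  obtain ⟨g, hg⟩ := exists_mul_eulerProd_eq_one 2 one_le_two
  have heg : eulerProd 4 * expand 2 two_ne_zero g = 1 := by
    rw [← expand_two_eulerProd 2 one_le_two, ← map_mul, hg, map_one]
  have hc0 : constantCoeff (theta ^ 4 - evalNegHom theta ^ 4) = 0 := by
    have : constantCoeff (evalNegHom theta) = 1 := by
      rw [← coeff_zero_eq_constantCoeff_apply, coeff_evalNegHom, coeff_zero_eq_constantCoeff_apply,
        constantCoeff_theta]
      simp
    simp [this, constantCoeff_theta]
  obtain ⟨j, hj⟩ := X_dvd_iff.2 hc0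
  have hjc : constantCoeff j = 16 := by
    have h1 : coeff 1 theta = 2 := by
      rw [coeff_theta, ← one_pow 2, sqRoots_sq]
      rfl
    obtain ⟨u, hu⟩ : X ∣ theta - 1 := X_dvd_iff.2 (by simp [constantCoeff_theta])
    have hu' : theta = 1 + X * u := by rw [← hu]; ring
    have hu0 : constantCoeff u = 2 := by
      rw [← h1, hu', ← coeff_zero_eq_constantCoeff_apply, map_add, coeff_one, ← zero_add 1,
        coeff_succ_X_mul]
      simp
    have hv : evalNegHom theta = 1 - X * evalNegHom u := by
      rw [hu', map_add, map_one, map_mul, evalNegHom_X]; ring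
    have hv0 : constantCoeff (evalNegHom u) = 2 := by
      rw [← coeff_zero_eq_constantCoeff_apply, coeff_evalNegHom, coeff_zero_eq_constantCoeff_apply,
        hu0]
      simp
    have hj' : j = (u + evalNegHom u) * (theta + evalNegHom theta) *
        (theta ^ 2 + evalNegHom theta ^ 2) := by
      refine mul_left_cancel₀ (X_ne_zero (R := ℤ)) ?_
      rw [← hj]
      linear_combination (theta + evalNegHom theta) *
        (theta ^ 2 + evalNegHom theta ^ 2) * (hu' - hv)
    rw [hj', hv, hu']
    simp [hu0, hv0]
  have hj2 : j ^ 2 = 16 * expand 2 two_ne_zero theta ^ 4 * expand 2 two_ne_zero j := by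
    have he := congrArg (expand 2 two_ne_zero) hj
    rw [map_sub, map_pow, map_pow, map_mul, expand_X] at he
    refine mul_left_cancel₀ (pow_ne_zero 2 (X_ne_zero (R := ℤ))) ?_
    have hB := theta_sq_add
    have hP := theta_mul_evalNegHom_theta
    have hJ : theta ^ 4 - evalNegHom theta ^ 4 =
        (theta ^ 2 - evalNegHom theta ^ 2) * (2 * expand 2 two_ne_zero theta ^ 2) := by
      rw [← hB]; ring
    have hD : (theta ^ 2 - evalNegHom theta ^ 2) ^ 2 = 4 * (expand 2 two_ne_zero theta ^ 4 -
        expand 2 two_ne_zero (evalNegHom theta) ^ 4) := by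
      calc (theta ^ 2 - evalNegHom theta ^ 2) ^ 2
          = (theta ^ 2 + evalNegHom theta ^ 2) ^ 2 - 4 * (theta * evalNegHom theta) ^ 2 := by ring
        _ = _ := by rw [hB, hP]; ring
    calc X ^ 2 * j ^ 2 = (theta ^ 4 - evalNegHom theta ^ 4) ^ 2 := by rw [hj]; ring
      _ = 4 * expand 2 two_ne_zero theta ^ 4 * (theta ^ 2 - evalNegHom theta ^ 2) ^ 2 := by
        rw [hJ]; ring
      _ = _ := by rw [hD, he]; ring
  have hy2 : (16 * eulerProd 4 ^ 8 * g ^ 4) ^ 2 = 16 * expand 2 two_ne_zero theta ^ 4 *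
      expand 2 two_ne_zero (16 * eulerProd 4 ^ 8 * g ^ 4) := by
    have hth := expand_theta_mul
    have hth4 : expand 2 two_ne_zero theta ^ 4 * eulerProd 8 ^ 8 = eulerProd 4 ^ 20 * g ^ 8 := by
      calc expand 2 two_ne_zero theta ^ 4 * eulerProd 8 ^ 8
          = (expand 2 two_ne_zero theta * eulerProd 2 ^ 2 * eulerProd 8 ^ 2) ^ 4 * g ^ 8 -
            expand 2 two_ne_zero theta ^ 4 * eulerProd 8 ^ 8 * ((eulerProd 2 * g) ^ 8 - 1) := by
            ring
        _ = _ := by rw [hth, hg]; ring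
    have h16 : expand 2 two_ne_zero (16 : PowerSeries ℤ) = 16 := map_ofNat _ 16
    rw [map_mul, map_mul, map_pow, map_pow, expand_two_eulerProd 4 (by norm_num), h16]
    calc (16 * eulerProd 4 ^ 8 * g ^ 4) ^ 2
        = 256 * (eulerProd 4 ^ 20 * g ^ 8) * expand 2 two_ne_zero g ^ 4 -
          256 * eulerProd 4 ^ 16 * g ^ 8 * ((eulerProd 4 * expand 2 two_ne_zero g) ^ 4 - 1) := by
          ring
      _ = _ := by rw [← hth4, heg]; ring
  have hg0 : constantCoeff g = 1 := by
    have := congrArg constantCoeff hg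
    rwa [map_mul, constantCoeff_eulerProd 2 one_le_two, map_one, one_mul] at this
  have hfin := eq_of_sq_eq_mul_expand hj2 hy2
    (by simp [hjc, hg0, constantCoeff_eulerProd 4 (by norm_num),
      map_ofNat (constantCoeff (R := ℤ)) 16]) (by simp [hjc])
  rw [hj, hfin]
  calc eulerProd 2 ^ 4 * (X * (16 * eulerProd 4 ^ 8 * g ^ 4))
      = 16 * X * eulerProd 4 ^ 8 * (eulerProd 2 * g) ^ 4 := by ring
    _ = _ := by rw [hg]; ring

/-- The odd part of `f_1 ^ 8` is `-8 q f_4 ^ 8`. -/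
theorem evalNegHom_eulerProd_pow_eight :
    evalNegHom (eulerProd 1 ^ 8) = eulerProd 1 ^ 8 + 16 * X * eulerProd 4 ^ 8 := by
  have h1 := evalNegHom_eulerProd_one_sq
  have h2 := eulerProd_one_sq
  calc evalNegHom (eulerProd 1 ^ 8) = (evalNegHom (eulerProd 1) ^ 2) ^ 4 := by
        rw [map_pow]; ring
    _ = (eulerProd 1 ^ 2) ^ 4 + eulerProd 2 ^ 4 * (theta ^ 4 - evalNegHom theta ^ 4) := by
        rw [h1, h2]; ring
    _ = _ := by rw [theta_pow_four_sub]; ring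

theorem eulerProd_pow_eight_mul :
    eulerProd 1 ^ 8 * (eulerProd 1 ^ 8 + 16 * X * eulerProd 4 ^ 8) * eulerProd 4 ^ 8 =
      eulerProd 2 ^ 24 := by
  rw [← evalNegHom_eulerProd_pow_eight, map_pow, show 24 = 3 * 8 from rfl, pow_mul,
    ← evalNegHom_eulerProd_one]
  ring

/-! ### Sections of power series modulo 2 -/

/-- The operator `∑ a(n) q ^ n ↦ ∑ a(2 n + r) q ^ n`. -/
noncomputable def bisect (r : ℕ) : PowerSeries ℤ →+ PowerSeries ℤ where
  toFun a := mk fun n => coeff (2 * n + r) a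
  map_zero' := by ext n; simp
  map_add' a b := by ext n; simp

theorem coeff_bisect (r n : ℕ) (a : PowerSeries ℤ) :
    coeff n (bisect r a) = coeff (2 * n + r) a := by
  simp [bisect]

/-- Bisection is linear over the series in `q ^ 2`. -/
theorem bisect_expand_two_mul (r : ℕ) (hr : r < 2) (a b : PowerSeries ℤ) :
    bisect r (expand 2 two_ne_zero a * b) = a * bisect r b := by
  have key : b = expand 2 two_ne_zero (bisect 0 b) + X * expand 2 two_ne_zero (bisect 1 b) := by
    ext n
    rw [map_add]
    rcases n with _ | n
    · rw [coeff_zero_X_mul, add_zero, coeff_expand, if_pos (dvd_zero 2), coeff_bisect]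
    · rw [coeff_succ_X_mul, coeff_expand, coeff_expand, coeff_bisect, coeff_bisect]
      rcases Nat.even_or_odd' n with ⟨m, rfl | rfl⟩
      · rw [if_neg (by omega), if_pos (by omega), zero_add]
        congr 2
        omega
      · rw [if_pos (by omega), if_neg (by omega), add_zero]
        congr 2
        omega
  have h0 (u v : PowerSeries ℤ) :
      bisect 0 (expand 2 two_ne_zero u + X * expand 2 two_ne_zero v) = u := by
    ext n
    rw [coeff_bisect, map_add, add_zero, coeff_expand_mul]
    rcases n with _ | n
    · simp
    · rw [show 2 * (n + 1) = 2 * n + 1 + 1 by ring, coeff_succ_X_mul,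
        coeff_expand_of_not_dvd _ _ _ (by omega), add_zero]
  have h1 (u v : PowerSeries ℤ) :
      bisect 1 (expand 2 two_ne_zero u + X * expand 2 two_ne_zero v) = v := by
    ext n
    rw [coeff_bisect, map_add, coeff_succ_X_mul, coeff_expand_mul,
      coeff_expand_of_not_dvd _ _ _ (by omega), zero_add]
  have hab : expand 2 two_ne_zero a * b = expand 2 two_ne_zero (a * bisect 0 b) +
      X * expand 2 two_ne_zero (a * bisect 1 b) := by
    conv_lhs => rw [key]
    rw [map_mul, map_mul]
    ring
  rw [hab]
  interval_cases r
  · exact h0 _ _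
  · exact h1 _ _

theorem bisect_zero_expand_two (a : PowerSeries ℤ) : bisect 0 (expand 2 two_ne_zero a) = a := by
  ext n
  rw [coeff_bisect, add_zero, coeff_expand_mul]

theorem bisect_succ_X_mul (r : ℕ) (a : PowerSeries ℤ) : bisect (r + 1) (X * a) = bisect r a := by
  ext n
  rw [coeff_bisect, coeff_bisect, ← add_assoc, coeff_succ_X_mul]

theorem bisect_zero_X_mul (a : PowerSeries ℤ) : bisect 0 (X * a) = X * bisect 1 a := by
  ext n
  rw [coeff_bisect]
  rcases n with _ | n
  · simp
  · rw [coeff_succ_X_mul, coeff_bisect, show 2 * (n + 1) + 0 = 2 * n + 1 + 1 by ring,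
      coeff_succ_X_mul]

theorem bisect_zero_eq_of_add_evalNegHom (a b : PowerSeries ℤ)
    (h : a + evalNegHom a = 2 * expand 2 two_ne_zero b) : bisect 0 a = b := by
  ext n
  have := congrArg (coeff (2 * n)) h
  rw [map_add, coeff_evalNegHom, (even_two_mul n).neg_one_pow, two_mul (expand _ _ _), map_add,
    coeff_expand_mul] at this
  rw [coeff_bisect]
  simp only [add_zero]
  omega

theorem bisect_one_eq_of_sub_evalNegHom (a b : PowerSeries ℤ)
    (h : a - evalNegHom a = 2 * (X * expand 2 two_ne_zero b)) : bisect 1 a = b := by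
  ext n
  have := congrArg (coeff (2 * n + 1)) h
  rw [map_sub, coeff_evalNegHom, (odd_two_mul_add_one n).neg_one_pow, two_mul (X * _), map_add,
    coeff_succ_X_mul, coeff_expand_mul] at this
  rw [coeff_bisect]
  omega

theorem bisect_one_pow_eight : bisect 1 (eulerProd 1 ^ 8) = (-8 : ℤ) • eulerProd 2 ^ 8 := by
  apply bisect_one_eq_of_sub_evalNegHom
  rw [evalNegHom_eulerProd_pow_eight, map_zsmul, map_pow, expand_two_eulerProd 2 one_le_two,
    zsmul_eq_mul]
  push_cast
  ring

/-- The even part of `f_1 ^ 16`, where `w` stands for `f_1 ^ 24 / f_2 ^ 8`: it is read off from the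
product and the difference of `f_1(q) ^ 8` and `f_1(-q) ^ 8`. -/
theorem bisect_zero_pow_sixteen (w : PowerSeries ℤ) (hw : w * eulerProd 2 ^ 8 = eulerProd 1 ^ 24) :
    bisect 0 (eulerProd 1 ^ 16) = w + (128 : ℤ) • (X * eulerProd 2 ^ 16) := by
  apply bisect_zero_eq_of_add_evalNegHom
  have hw' := congrArg (expand 2 two_ne_zero) hw
  rw [map_mul, map_pow, map_pow, expand_two_eulerProd 1 le_rfl,
    expand_two_eulerProd 2 one_le_two] at hw'
  have h0 : eulerProd 4 ^ 8 ≠ 0 := pow_ne_zero _ (eulerProd_ne_zero 4 (by norm_num))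
  have hprod : eulerProd 1 ^ 8 * (eulerProd 1 ^ 8 + 16 * X * eulerProd 4 ^ 8) =
      expand 2 two_ne_zero w :=
    mul_right_cancel₀ h0 (by rw [eulerProd_pow_eight_mul, hw'])
  rw [show 16 = 8 * 2 from rfl, pow_mul, map_pow, evalNegHom_eulerProd_pow_eight, map_add,
    map_zsmul, map_mul, map_pow, expand_X, expand_two_eulerProd 2 one_le_two, ← hprod,
    zsmul_eq_mul]
  push_cast
  ring

/-- The action of the Hecke operator `U_2` on `Δ = q f_1 ^ 24`. -/
theorem bisect_one_pow_twentyfour : bisect 1 (eulerProd 1 ^ 24) =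
    (-24 : ℤ) • eulerProd 1 ^ 24 + (-2048 : ℤ) • (X * eulerProd 2 ^ 24) := by
  apply bisect_one_eq_of_sub_evalNegHom
  have h := eulerProd_pow_eight_mul
  rw [show eulerProd 1 ^ 24 = (eulerProd 1 ^ 8) ^ 3 by ring, map_pow,
    evalNegHom_eulerProd_pow_eight, map_add, map_zsmul, map_zsmul, map_mul, ← pow_mul, map_pow,
    map_pow, expand_X, expand_two_eulerProd 1 le_rfl, expand_two_eulerProd 2 one_le_two,
    zsmul_eq_mul, zsmul_eq_mul]
  push_cast
  linear_combination (-48 * X) * h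

/-! ### The two-dimensional spaces stable under bisection -/

/-- The matrix of the first bisection, in the bases `f_1 ^ (8 k)`, `q ^ m f_1 ^ (8 k - 24) f_2 ^ 24`
and `f_2 ^ (8 k)`, `q ^ (-m) f_1 ^ 24 f_2 ^ (8 k - 24)`, where `m = ⌊k / 2⌋`.
For `k = 1` the line of `f_1 ^ 8` is stable, and the second coordinate is set to zero. -/
def oddStep : ℕ → ℤ × ℤ → ℤ × ℤ
  | 1, p => (-8 * p.1, 0)
  | 2, p => (128 * p.1 + 8 * p.2, p.1)
  | 3, p => (-2048 * p.1, -24 * p.1 + p.2)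
  | _, p => p

/-- The matrix of the second bisection, from the second basis back to the first. -/
def evenStep (p : ℤ × ℤ) : ℤ × ℤ := (p.1 - 24 * p.2, -2048 * p.2)

/-- The coordinates `(A_k(n), B_k(n))`: the two bisections are applied alternately to `(1, 0)`. -/
def coords (k : ℕ) : ℕ → ℤ × ℤ
  | 0 => (1, 0)
  | n + 1 => if Even n then oddStep k (coords k n) else evenStep (coords k n)

theorem coords_two_mul_add_one (k n : ℕ) :
    coords k (2 * n + 1) = oddStep k (coords k (2 * n)) :=
  if_pos (even_two_mul n)

theorem coords_two_mul_add_two (k n : ℕ) :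
    coords k (2 * n + 2) = evenStep (coords k (2 * n + 1)) :=
  if_neg (by simp)

/-- The recurrence is the Cayley–Hamilton theorem for the products, in either order, of the
matrices of `oddStep k` and `evenStep`. -/
theorem coords_add_four (k : ℕ) (hk1 : 1 ≤ k) (hk3 : k ≤ 3) (n : ℕ) :
    (coords k (n + 4)).1 = recF k * (coords k (n + 2)).1 + recG k * (coords k n).1 ∧
    (coords k (n + 4)).2 = recF k * (coords k (n + 2)).2 + recG k * (coords k n).2 := by
  rcases Nat.even_or_odd' n with ⟨m, rfl | rfl⟩
  · rw [show 2 * m + 4 = 2 * (m + 1) + 2 by ring, coords_two_mul_add_two, coords_two_mul_add_one,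
      show 2 * (m + 1) = 2 * m + 2 by ring, coords_two_mul_add_two, coords_two_mul_add_one]
    generalize coords k (2 * m) = p
    interval_cases k <;> simp only [oddStep, evenStep, recF, recG] <;> constructor <;> ring
  · rw [show 2 * m + 1 + 4 = 2 * (m + 2) + 1 by ring, coords_two_mul_add_one,
      show 2 * (m + 2) = 2 * (m + 1) + 2 by ring, coords_two_mul_add_two,
      show 2 * m + 1 + 2 = 2 * (m + 1) + 1 by ring, coords_two_mul_add_one,
      show 2 * (m + 1) = 2 * m + 2 by ring, coords_two_mul_add_two]
    generalize coords k (2 * m + 1) = p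
    interval_cases k <;> simp only [oddStep, evenStep, recF, recG] <;> constructor <;> ring

theorem coords_init (k : ℕ) (hk1 : 1 ≤ k) (hk3 : k ≤ 3) (i : Fin 4) :
    (coords k i).1 = initA k i ∧ (coords k i).2 = initB k i := by
  interval_cases k <;> fin_cases i <;> decide

theorem coords_one_snd (n : ℕ) : (coords 1 n).2 = 0 := by
  induction n with
  | zero => rfl
  | succ n ih =>
    rw [coords]
    split_ifs
    · rfl
    · simp [evenStep, ih]

/-- Bisection `n ↦ 2 n + (k mod 2)` of the space spanned by `f_1 ^ (8 k)` and
`q ^ m f_1 ^ (8 k - 24) f_2 ^ 24`. For `k = 1` the second vector never occurs. -/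
theorem bisect_mod_two (k : ℕ) (hk1 : 1 ≤ k) (hk3 : k ≤ 3) (u w : PowerSeries ℤ)
    (hu : u * eulerProd 1 ^ (24 - 8 * k) = eulerProd 2 ^ 24)
    (hw : w * eulerProd 2 ^ (24 - 8 * k) = eulerProd 1 ^ 24) (p : ℤ × ℤ) (hp : k = 1 → p.2 = 0) :
    bisect (k % 2) (p.1 • eulerProd 1 ^ (8 * k) + p.2 • (X ^ (k / 2) * u)) =
      (oddStep k p).1 • (X ^ (k / 2) * eulerProd 2 ^ (8 * k)) + (oddStep k p).2 • w := by
  obtain ⟨A, B⟩ := p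
  interval_cases k
  · obtain rfl : B = 0 := hp rfl
    simp only [oddStep, zero_smul, add_zero, map_zsmul, Nat.reduceMod, Nat.reduceDiv, pow_zero,
      one_mul, mul_one, bisect_one_pow_eight, smul_smul]
    congr 1
    ring
  · have hw' : w * eulerProd 2 ^ 8 = eulerProd 1 ^ 24 := hw
    have hu' : u = eulerProd 4 ^ 8 * eulerProd 1 ^ 8 +
        (16 : ℤ) • (eulerProd 4 ^ 8 * (X * eulerProd 4 ^ 8)) := by
      refine mul_right_cancel₀ (pow_ne_zero 8 (eulerProd_ne_zero 1 le_rfl)) ?_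
      rw [show u * eulerProd 1 ^ 8 = eulerProd 2 ^ 24 from hu, ← eulerProd_pow_eight_mul,
        zsmul_eq_mul]
      push_cast
      ring
    have he : eulerProd 4 ^ 8 = expand 2 two_ne_zero (eulerProd 2 ^ 8) := by
      rw [map_pow, expand_two_eulerProd 2 one_le_two]
    have hX : bisect 1 (X * expand 2 two_ne_zero (eulerProd 2 ^ 8)) = eulerProd 2 ^ 8 := by
      rw [bisect_succ_X_mul, bisect_zero_expand_two]
    have hb : bisect 0 (X * u) = (8 : ℤ) • (X * eulerProd 2 ^ 16) := by
      rw [bisect_zero_X_mul, hu', he, map_add, map_zsmul, bisect_expand_two_mul _ one_lt_two,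
        bisect_expand_two_mul _ one_lt_two, hX, bisect_one_pow_eight]
      simp only [zsmul_eq_mul]
      push_cast
      ring
    simp only [oddStep, map_add, map_zsmul, Nat.reduceMod, Nat.reduceDiv, pow_one, Nat.reduceMul,
      hb, bisect_zero_pow_sixteen w hw']
    simp only [zsmul_eq_mul]
    push_cast
    ring
  · obtain rfl : u = eulerProd 2 ^ 24 := by simpa using hu
    obtain rfl : w = eulerProd 1 ^ 24 := by simpa using hw
    have hb : bisect 1 (X * eulerProd 2 ^ 24) = eulerProd 1 ^ 24 := by
      rw [bisect_succ_X_mul, ← expand_two_eulerProd 1 le_rfl, ← map_pow, bisect_zero_expand_two]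
    simp only [oddStep, map_add, map_zsmul, Nat.reduceMod, Nat.reduceDiv, pow_one, Nat.reduceMul,
      hb, bisect_one_pow_twentyfour]
    simp only [zsmul_eq_mul]
    push_cast
    ring

/-- Bisection `n ↦ 2 n` of the space spanned by `f_2 ^ (8 k)` and
`q ^ (-m) f_1 ^ 24 f_2 ^ (8 k - 24)`; multiplication by `q ^ m` shifts it to `n ↦ 2 n + m`. -/
theorem bisect_div_two (k : ℕ) (hk1 : 1 ≤ k) (hk3 : k ≤ 3) (u w : PowerSeries ℤ)
    (hu : u * eulerProd 1 ^ (24 - 8 * k) = eulerProd 2 ^ 24)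
    (hw : w * eulerProd 2 ^ (24 - 8 * k) = eulerProd 1 ^ 24) (p : ℤ × ℤ) (hp : k = 1 → p.2 = 0) :
    bisect (k / 2) (p.1 • (X ^ (k / 2) * eulerProd 2 ^ (8 * k)) + p.2 • w) =
      (evenStep p).1 • eulerProd 1 ^ (8 * k) + (evenStep p).2 • (X ^ (k / 2) * u) := by
  obtain ⟨A, B⟩ := p
  have he (j : ℕ) : eulerProd 2 ^ j = expand 2 two_ne_zero (eulerProd 1 ^ j) := by
    rw [map_pow, expand_two_eulerProd 1 le_rfl]
  rcases hk1.eq_or_lt with rfl | hk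
  · obtain rfl : B = 0 := hp rfl
    simp only [evenStep, he, bisect_zero_expand_two, zero_smul, add_zero, map_zsmul, Nat.reduceDiv,
      pow_zero, one_mul, mul_zero, sub_zero]
  have hk2 : k / 2 = 1 := by omega
  have hX : bisect 1 (X * eulerProd 2 ^ (8 * k)) = eulerProd 1 ^ (8 * k) := by
    rw [he, bisect_succ_X_mul, bisect_zero_expand_two]
  -- `f_2 ^ (24 - 8 k)` is a series in `q ^ 2`, so it passes through the bisection.
  have hb : bisect 1 w =
      (-24 : ℤ) • eulerProd 1 ^ (8 * k) + (-2048 : ℤ) • (X * u) := by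
    refine mul_left_cancel₀ (pow_ne_zero (24 - 8 * k) (eulerProd_ne_zero 1 le_rfl)) ?_
    rw [← bisect_expand_two_mul _ one_lt_two, ← he, mul_comm, hw, bisect_one_pow_twentyfour, ← hu]
    have : eulerProd 1 ^ 24 = eulerProd 1 ^ (24 - 8 * k) * eulerProd 1 ^ (8 * k) := by
      rw [← pow_add]
      congr 1
      omega
    rw [this]
    simp only [zsmul_eq_mul]
    ring
  simp only [hk2, pow_one, map_add, map_zsmul, hX, hb, evenStep]
  simp only [zsmul_eq_mul]
  push_cast
  ring

/-! ### Iterated bisection -/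

/-- The result of applying `bisect (k % 2)` and then `bisect (k / 2)` to `f_1 ^ (8 k)`, in this order
and `α` times; it collects the coefficients of index `4 ^ α n + k (4 ^ α - 1) / 3`. -/
noncomputable def evenSection (k : ℕ) : ℕ → PowerSeries ℤ
  | 0 => eulerProd 1 ^ (8 * k)
  | α + 1 => bisect (k / 2) (bisect (k % 2) (evenSection k α))

theorem four_pow_succ_sub_one_div_three (α : ℕ) :
    (4 ^ (α + 1) - 1) / 3 = 4 ^ α + (4 ^ α - 1) / 3 := by
  rw [pow_succ]
  have := Nat.one_le_pow α 4 (by norm_num)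
  omega

theorem coeff_evenSection (k α n : ℕ) :
    coeff n (evenSection k α) =
      coeff (4 ^ α * n + k * ((4 ^ α - 1) / 3)) (eulerProd 1 ^ (8 * k)) := by
  induction α generalizing n with
  | zero => simp [evenSection]
  | succ α ih =>
    rw [evenSection, coeff_bisect, coeff_bisect, ih]
    congr 2
    have h2 := Nat.div_add_mod k 2
    rw [four_pow_succ_sub_one_div_three, pow_succ]
    calc _ = 4 ^ α * (4 * n + (2 * (k / 2) + k % 2)) + k * ((4 ^ α - 1) / 3) := by ring
      _ = _ := by rw [h2]; ring

theorem evenSection_eq (k : ℕ) (hk1 : 1 ≤ k) (hk3 : k ≤ 3) (u w : PowerSeries ℤ)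
    (hu : u * eulerProd 1 ^ (24 - 8 * k) = eulerProd 2 ^ 24)
    (hw : w * eulerProd 2 ^ (24 - 8 * k) = eulerProd 1 ^ 24) (α : ℕ) :
    evenSection k α = (coords k (2 * α)).1 • eulerProd 1 ^ (8 * k) +
      (coords k (2 * α)).2 • (X ^ (k / 2) * u) := by
  have hp (n : ℕ) : k = 1 → (coords k n).2 = 0 := by
    rintro rfl
    exact coords_one_snd n
  induction α with
  | zero => simp [evenSection, coords]
  | succ α ih =>
    rw [evenSection, ih, bisect_mod_two k hk1 hk3 u w hu hw _ (hp _), ← coords_two_mul_add_one,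
      bisect_div_two k hk1 hk3 u w hu hw _ (hp _), ← coords_two_mul_add_two]
    rfl

/-- The remaining bisection `n ↦ 2 n + (k mod 2)`; the index `n` is shifted by `⌊k / 2⌋` with respect
to the Laurent series of the theorem. -/
theorem bisect_evenSection_eq (k : ℕ) (hk1 : 1 ≤ k) (hk3 : k ≤ 3) (u w : PowerSeries ℤ)
    (hu : u * eulerProd 1 ^ (24 - 8 * k) = eulerProd 2 ^ 24)
    (hw : w * eulerProd 2 ^ (24 - 8 * k) = eulerProd 1 ^ 24) (α : ℕ) :
    bisect (k % 2) (evenSection k α) =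
      (coords k (2 * α + 1)).1 • (X ^ (k / 2) * eulerProd 2 ^ (8 * k)) +
      (coords k (2 * α + 1)).2 • w := by
  rw [evenSection_eq k hk1 hk3 u w hu hw, bisect_mod_two k hk1 hk3 u w hu hw,
    ← coords_two_mul_add_one]
  rintro rfl
  exact coords_one_snd _

/-! ### Laurent series -/

/-- The inclusion of `ℤ⟦q⟧` into the Laurent series over `ℚ`. -/
noncomputable def toLaurent : PowerSeries ℤ →+* LaurentSeries ℚ :=
  (HahnSeries.ofPowerSeries ℤ ℚ).comp (PowerSeries.map (Int.castRingHom ℚ))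

theorem toLaurent_eulerProd (t : ℕ) : toLaurent (eulerProd t) = eulerLaurent t := rfl

theorem toLaurent_X_pow (n : ℕ) : toLaurent (X ^ n) = qPow n := by
  simp [toLaurent, qPow, HahnSeries.ofPowerSeries_X_pow]

theorem qPow_neg_mul_toLaurent_X_pow (n : ℕ) : qPow (-(n : ℤ)) * toLaurent (X ^ n) = 1 := by
  rw [toLaurent_X_pow, qPow, qPow, HahnSeries.single_mul_single, neg_add_cancel, one_mul]
  rfl

/-- A Laurent series that starts at `q ^ (-m)` is `q ^ (-m)` times a power series. -/
theorem laurentSum_eq (m : ℕ) (a : ℤ → ℤ) (p : PowerSeries ℤ)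
    (h : ∀ n : ℕ, a (n - m) = coeff n p) :
    laurentSum (-(m : ℤ)) a = qPow (-(m : ℤ)) * toLaurent p := by
  ext n
  change (if -(m : ℤ) ≤ n then (a n : ℚ) else 0) = _
  rw [qPow, HahnSeries.coeff_single_mul, one_mul,
    toLaurent, RingHom.comp_apply]
  have hc := PowerSeries.coeff_coe (PowerSeries.map (Int.castRingHom ℚ) p) (n - -(m : ℤ))
  rw [hc]
  split_ifs with h1 h2 h2
  · omega
  · obtain ⟨j, hj⟩ := Int.eq_ofNat_of_zero_le (show 0 ≤ n + m by omega)
    have hn : n = j - m := by omega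
    subst hn
    rw [h, coeff_map, eq_intCast]
    congr 3
    omega
  · rfl
  · omega

/-- A quotient `f_t ^ 24 / f_s ^ (24 - j)` of power series, written with integer powers. -/
theorem eulerLaurent_zpow {s t j : ℕ} (hs : 1 ≤ s) (hj : j ≤ 24) (u : PowerSeries ℤ)
    (hu : u * eulerProd s ^ (24 - j) = eulerProd t ^ 24) :
    toLaurent u = eulerLaurent s ^ ((j : ℤ) - 24) * eulerLaurent t ^ (24 : ℤ) := by
  have h := congrArg toLaurent hu
  rw [map_mul, map_pow, map_pow, toLaurent_eulerProd, toLaurent_eulerProd] at h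
  have h0 := eulerLaurent_ne_zero s hs
  rw [show (j : ℤ) - 24 = -((24 - j : ℕ) : ℤ) by omega, zpow_neg, zpow_natCast,
    show (24 : ℤ) = ((24 : ℕ) : ℤ) from rfl, zpow_natCast, ← h]
  field_simp

theorem exists_mul_eulerProd_pow_eq (s : ℕ) (hs : 1 ≤ s) (j : ℕ) (a : PowerSeries ℤ) :
    ∃ u, u * eulerProd s ^ j = a := by
  obtain ⟨g, hg⟩ := exists_mul_eulerProd_eq_one s hs
  exact ⟨a * g ^ j, by rw [mul_assoc, ← mul_pow, mul_comm g, hg, one_pow, mul_one]⟩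

theorem four_pow_sub_one_div_three (k α : ℕ) :
    (k : ℤ) * (2 ^ (2 * α) - 1) / 3 = ((k * ((4 ^ α - 1) / 3) : ℕ) : ℤ) := by
  have h3 : 3 ∣ 4 ^ α - 1 := by simpa using Nat.sub_dvd_pow_sub_pow 4 1 α
  obtain ⟨c, hc⟩ := h3
  have h1 := Nat.one_le_pow α 4 (by norm_num)
  have h4 : (2 : ℤ) ^ (2 * α) - 1 = 3 * c := by
    rw [pow_mul]
    zify [h1] at hc
    rw [← hc]
    norm_num
  rw [hc, h4, Nat.mul_div_cancel_left _ (by norm_num), mul_left_comm,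
    Int.mul_ediv_cancel_left _ (by norm_num)]
  push_cast
  ring

theorem pCoeff_natCast (k n : ℕ) : pCoeff k n = coeff n (eulerProd 1 ^ k) := by
  simp [pCoeff]

theorem theorem1p1 (k : ℕ) (hk1 : 1 ≤ k) (hk3 : k ≤ 3) :
    ∃ A B : ℕ → ℤ,
      (∀ i : Fin 4, A i = initA k i) ∧
      (∀ i : Fin 4, B i = initB k i) ∧
      (∀ α : ℕ, A (α + 4) = recF k * A (α + 2) + recG k * A α) ∧
      (∀ α : ℕ, B (α + 4) = recF k * B (α + 2) + recG k * B α) ∧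
      ∀ α : ℕ,
        laurentSum 0
            (fun n => pCoeff (8 * k) (2 ^ (2 * α) * n + (k : ℤ) * (2 ^ (2 * α) - 1) / 3)) =
          (A (2 * α) : LaurentSeries ℚ) * eulerLaurent 1 ^ (8 * (k : ℤ)) +
            (B (2 * α) : LaurentSeries ℚ) * qPow ((k / 2 : ℕ) : ℤ) *
              eulerLaurent 1 ^ (8 * (k : ℤ) - 24) * eulerLaurent 2 ^ (24 : ℤ) ∧
        laurentSum (-((k / 2 : ℕ) : ℤ))
            (fun n => pCoeff (8 * k)
              (2 ^ (2 * α + 1) * n + (k : ℤ) * (2 ^ (2 * α + 2) - 1) / 3)) =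
          (A (2 * α + 1) : LaurentSeries ℚ) * eulerLaurent 2 ^ (8 * (k : ℤ)) +
            (B (2 * α + 1) : LaurentSeries ℚ) * qPow (-((k / 2 : ℕ) : ℤ)) *
              eulerLaurent 1 ^ (24 : ℤ) * eulerLaurent 2 ^ (8 * (k : ℤ) - 24) := by
  obtain ⟨u, hu⟩ := exists_mul_eulerProd_pow_eq 1 le_rfl (24 - 8 * k) (eulerProd 2 ^ 24)
  obtain ⟨w, hw⟩ := exists_mul_eulerProd_pow_eq 2 one_le_two (24 - 8 * k) (eulerProd 1 ^ 24)
  have hu' := eulerLaurent_zpow le_rfl (by omega) u hu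
  have hw' := eulerLaurent_zpow one_le_two (by omega) w hw
  have h8 : (8 : ℤ) * k = ((8 * k : ℕ) : ℤ) := by push_cast; rfl
  refine ⟨fun n => (coords k n).1, fun n => (coords k n).2, fun i => (coords_init k hk1 hk3 i).1,
    fun i => (coords_init k hk1 hk3 i).2, fun n => (coords_add_four k hk1 hk3 n).1,
    fun n => (coords_add_four k hk1 hk3 n).2, fun α => ⟨?_, ?_⟩⟩
  · have h := laurentSum_eq 0 (fun n => pCoeff (8 * k) (2 ^ (2 * α) * n +
      (k : ℤ) * (2 ^ (2 * α) - 1) / 3)) (evenSection k α) fun n => by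
        rw [coeff_evenSection, ← pCoeff_natCast, four_pow_sub_one_div_three, pow_mul]
        push_cast
        congr 2
    rw [Nat.cast_zero, neg_zero] at h
    rw [h, evenSection_eq k hk1 hk3 u w hu hw, map_add, map_zsmul, map_zsmul, map_mul, map_pow,
      toLaurent_X_pow, hu', toLaurent_eulerProd, h8, zpow_natCast, zsmul_eq_mul, zsmul_eq_mul]
    have h0 : qPow 0 = 1 := rfl
    rw [h0]
    ring
  · rw [laurentSum_eq (k / 2) _ (bisect (k % 2) (evenSection k α)),
      bisect_evenSection_eq k hk1 hk3 u w hu hw, map_add, map_zsmul, map_zsmul, map_mul,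
      map_pow _ _ (8 * k), hw', toLaurent_eulerProd, h8, zpow_natCast, zsmul_eq_mul, zsmul_eq_mul]
    · linear_combination ((coords k (2 * α + 1)).1 * eulerLaurent 2 ^ (8 * k) : LaurentSeries ℚ) *
        qPow_neg_mul_toLaurent_X_pow (k / 2)
    · intro n
      -- Both indices equal `4 ^ α (2 n + k mod 2) + k (4 ^ α - 1) / 3`, as `k = 2 ⌊k / 2⌋ + k mod 2`.
      rw [coeff_bisect, coeff_evenSection, ← pCoeff_natCast,
        show 2 * α + 2 = 2 * (α + 1) by ring, four_pow_sub_one_div_three]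
      have h2 : (k : ℤ) = 2 * (k / 2 : ℕ) + (k % 2 : ℕ) := by omega
      have h4 : (2 : ℤ) ^ (2 * α + 1) = 2 * 4 ^ α := by rw [pow_succ, pow_mul]; ring
      rw [four_pow_succ_sub_one_div_three, h4]
      generalize (4 ^ α - 1) / 3 = c
      congr 1
      push_cast at h2 ⊢
      linear_combination (4 : ℤ) ^ α * h2
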